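/- Let $n\ge 1$, let $W=[W_{ij}]$ and $P=[P_{ij}]$ be symmetric real $n\times n$ matrices with $|W_{ij}|\le 1$ and $0\le P_{ij}\le 1$ for all $i,j$, and let $A=[A_{ij}]$ be a random symmetric $n\times n$ matrix whose entries $A_{ij}$, $1\le i\le j\le n$, are independent, with $A_{ij}=W_{ij}$ with probability $P_{ij}$ and $A_{ij}=0$ with probability $1-P_{ij}$ (the adjacency matrix of a random weighted graph with independent edges, self-loops allowed). For a square matrix $M$, let $L_M=\mathrm{diag}(M\mathbf 1)-M$ be its Laplacian matrix, where $\mathbf 1$ is the all-ones vector; let $\mathbb{E}A$ be the entrywise expectation of $A$, and let $\|\cdot\|$ be the spectral norm. Put $\Delta=\max_i\sum_{j=1}^n P_{ij}W_{ij}^2$. Let $c>0$ and suppose that $\Delta\ge 16(c+1)\log n$. Then, for every $\delta$ with $4n^{-c}\le\delta<1$, $$\mathbb{P}\left(\|L_A-L_{\mathbb{E}A}\|\le 8\sqrt{\Delta\log(4n/\delta)}\right)\ge 1-\delta .$$ -/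

import Mathlib

open MeasureTheory ProbabilityTheory
open scoped Matrix.Norms.L2Operator

/-- The Laplacian matrix `L_A = D_A - A` of a weighted adjacency matrix `A`, where
`D_A = diag (A 1)` is the diagonal matrix of the row sums of `A`. -/
def weightedLaplacian {n : ℕ} (A : Matrix (Fin n) (Fin n) ℝ) : Matrix (Fin n) (Fin n) ℝ :=
  Matrix.diagonal (fun i => ∑ j, A i j) - A

/-- The entrywise expectation of a random matrix. -/
noncomputable def expectedMatrix {n : ℕ} {Ω : Type*} [MeasurableSpace Ω] (μ : Measure Ω)
    (A : Ω → Matrix (Fin n) (Fin n) ℝ) : Matrix (Fin n) (Fin n) ℝ :=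
  Matrix.of fun i j => ∫ ω, A ω i j ∂μ

/-- `Δ = max_i ∑_j P_ij W_ij ^ 2`. -/
noncomputable def maxWeightedDegree {n : ℕ} (W P : Matrix (Fin n) (Fin n) ℝ) : ℝ :=
  ⨆ i, ∑ j, P i j * W i j ^ 2

/-- `A` is the adjacency matrix of a random weighted graph with independent edges, with weights `W`
and edge probabilities `P`: it is symmetric, its entries `A_ij` with `i ≤ j` (self-loops included)
are independent, and `A_ij` is `W_ij` with probability `P_ij` and `0` with probability
`1 - P_ij`. -/
structure IsIndepEdgeWeightedGraph {n : ℕ} {Ω : Type*} [MeasurableSpace Ω] (μ : Measure Ω)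
    (W P : Matrix (Fin n) (Fin n) ℝ) (A : Ω → Matrix (Fin n) (Fin n) ℝ) : Prop where
  symm : ∀ ω i j, A ω j i = A ω i j
  measurable : ∀ i j, Measurable (fun ω => A ω i j)
  law : ∀ i j, i ≤ j → μ.map (fun ω => A ω i j) =
    ENNReal.ofReal (P i j) • Measure.dirac (W i j) +
      ENNReal.ofReal (1 - P i j) • Measure.dirac (0 : ℝ)
  indep : iIndepFun
    (fun (e : {e : Fin n × Fin n // e.1 ≤ e.2}) (ω : Ω) => A ω e.1.1 e.1.2) μ

/-! The proof is a trace moment bound obtained by resampling edges. Each edge Laplacian satisfies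
`L_e ^ 2 = 2 L_e`, and `X = L_A - L_{EA}` is a sum of independent centered terms `Y_e = y_e L_e`.
Replacing `Y_e` by an independent copy turns `X` into `X'`, and exchangeability gives `E tr (Y_e
X^(2m+1)) = E tr ((Y_e - Y_e') (X^(2m+1) - X'^(2m+1))) / 2`. A mean value inequality for odd powers
under the trace (`trace_sub_mul_pow_sub_le`) bounds this by `(2m+1)/2 * E tr ((Y_e^2 + E Y_e^2)
X^(2m))`.

Summed over `e`, the variance proxy is again a graph Laplacian, with random nonnegative weights, so
it is at most twice its largest degree (`sum_mul_trace_laplacian_le`). Young's inequality absorbs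
the remaining power of `X`, which leaves moments of degrees, that is, of scalar sums of independent
bounded variables (`sum_prodWeight_mul_pow_le`). Markov's inequality with `m + 1` about `2 log
(4n/δ)` finishes the proof. -/

/-! ### Scalar power inequalities. -/

theorem pow_mul_pow_add_pow_mul_pow_le {a b : ℝ} (ha : 0 ≤ a) (hb : 0 ≤ b) (s r : ℕ) :
    a ^ s * b ^ r + a ^ r * b ^ s ≤ a ^ (s + r) + b ^ (s + r) := by
  have h : 0 ≤ (a ^ s - b ^ s) * (a ^ r - b ^ r) := by
    rcases le_total a b with h | h
    · exact mul_nonneg_of_nonpos_of_nonpos (sub_nonpos.2 (pow_le_pow_left₀ ha h s))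
        (sub_nonpos.2 (pow_le_pow_left₀ ha h r))
    · exact mul_nonneg (sub_nonneg.2 (pow_le_pow_left₀ hb h s))
        (sub_nonneg.2 (pow_le_pow_left₀ hb h r))
  rw [pow_add, pow_add]
  linarith

/-- Factor `a - b` out of the difference of powers; in the remaining geometric sum, pair each term
with its reflection and bound the pair by `pow_mul_pow_add_pow_mul_pow_le`. -/
theorem sub_mul_odd_pow_sub_le (a b : ℝ) (m : ℕ) :
    (a - b) * (a ^ (2 * m + 1) - b ^ (2 * m + 1)) ≤
      (2 * m + 1) / 2 * ((a - b) ^ 2 * (a ^ (2 * m) + b ^ (2 * m))) := by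
  have hgeom := (Commute.all a b).geom_sum₂_mul (2 * m + 1)
  have habs : ∀ z : ℝ, |z| ^ (2 * m) = z ^ (2 * m) := fun z => (even_two_mul m).pow_abs z
  have hsum : 2 * ∑ i ∈ Finset.range (2 * m + 1), |a| ^ i * |b| ^ (2 * m + 1 - 1 - i) ≤
      (2 * m + 1) * (a ^ (2 * m) + b ^ (2 * m)) := by
    rw [two_mul]
    nth_rewrite 2 [← Finset.sum_range_reflect]
    rw [← Finset.sum_add_distrib]
    refine (Finset.sum_le_card_nsmul _ _ (a ^ (2 * m) + b ^ (2 * m)) fun i hi => ?_).trans_eq ?_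
    · have hi' : i ≤ 2 * m := by simpa [Nat.lt_succ_iff] using hi
      have h := pow_mul_pow_add_pow_mul_pow_le (abs_nonneg a) (abs_nonneg b) i (2 * m - i)
      rw [Nat.add_sub_cancel' hi', habs, habs] at h
      have h2 : 2 * m + 1 - 1 - (2 * m + 1 - 1 - i) = i := by omega
      rw [h2]
      simpa using h
    · simp [mul_add]
  have hle : ∑ i ∈ Finset.range (2 * m + 1), a ^ i * b ^ (2 * m + 1 - 1 - i) ≤
      ∑ i ∈ Finset.range (2 * m + 1), |a| ^ i * |b| ^ (2 * m + 1 - 1 - i) :=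
    Finset.sum_le_sum fun i _ => by
      rw [← abs_pow, ← abs_pow, ← abs_mul]
      exact le_abs_self _
  rw [← hgeom]
  nlinarith [mul_le_mul_of_nonneg_left (hle.trans (by linarith : _ ≤ (2 * m + 1) / 2 *
    (a ^ (2 * m) + b ^ (2 * m)))) (sq_nonneg (a - b))]

/-- Young's inequality with integer exponents, obtained from Bernoulli's inequality for `(a / b) ^
(m + 1)`. -/
theorem nat_mul_mul_pow_le {a b : ℝ} (ha : 0 ≤ a) (hb : 0 ≤ b) (m : ℕ) :
    (m + 1) * (a * b ^ m) ≤ a ^ (m + 1) + m * b ^ (m + 1) := by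
  rcases hb.eq_or_lt with rfl | hb
  · rcases m with _ | m
    · simp
    · simp; positivity
  · have h := one_add_mul_le_pow (a := a / b - 1) (by have := div_nonneg ha hb.le; linarith) (m + 1)
    rw [add_sub_cancel, div_pow] at h
    have h2 := mul_le_mul_of_nonneg_right h (pow_pos hb (m + 1)).le
    rw [div_mul_cancel₀ _ (pow_pos hb (m + 1)).ne'] at h2
    refine le_of_eq_of_le ?_ (add_le_add_left h2 _)
    push_cast
    field_simp
    ring

/-! ### Trace inequalities for Hermitian matrices. -/

section Spectral

variable {ι : Type*} [Fintype ι] [DecidableEq ι]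

namespace Matrix.IsHermitian

theorem pow_eq_conj {A : Matrix ι ι ℝ} (hA : A.IsHermitian) (k : ℕ) :
    A ^ k = (hA.eigenvectorUnitary : Matrix ι ι ℝ) * diagonal (fun i => hA.eigenvalues i ^ k) *
      star (hA.eigenvectorUnitary : Matrix ι ι ℝ) := by
  have h := congrArg (· ^ k) hA.spectral_theorem
  simp only [← map_pow, diagonal_pow] at h
  rw [h, Unitary.conjStarAlgAut_apply]
  congr 2

/-- The weights are squared inner products of eigenvectors, hence nonnegative and independent of the
exponents. A scalar inequality in monomials `a ^ s * b ^ r` thus lifts to traces. -/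
theorem trace_pow_mul_pow {A B : Matrix ι ι ℝ} (hA : A.IsHermitian) (hB : B.IsHermitian)
    (a b : ℕ) :
    trace (A ^ a * B ^ b) = ∑ i, ∑ j, hA.eigenvalues i ^ a * hB.eigenvalues j ^ b *
      (star (hA.eigenvectorUnitary : Matrix ι ι ℝ) *
        (hB.eigenvectorUnitary : Matrix ι ι ℝ)) i j ^ 2 := by
  rw [hA.pow_eq_conj, hB.pow_eq_conj]
  set U := (hA.eigenvectorUnitary : Matrix ι ι ℝ)
  set V := (hB.eigenvectorUnitary : Matrix ι ι ℝ)
  set D := diagonal fun i => hA.eigenvalues i ^ a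
  set F := diagonal fun i => hB.eigenvalues i ^ b
  have h1 : trace (U * D * star U * (V * F * star V)) =
      trace (D * (star U * V) * (F * star (star U * V))) := by
    rw [star_mul, star_star, Matrix.mul_assoc U D, Matrix.mul_assoc U, Matrix.trace_mul_comm]
    simp only [Matrix.mul_assoc]
  rw [h1, Matrix.trace]
  simp only [diag_apply, Matrix.mul_apply (M := D * _), D, F, diagonal_mul, star_apply,
    star_trivial]
  exact Finset.sum_congr rfl fun i _ => Finset.sum_congr rfl fun j _ => by ring

theorem trace_pow_eq_sum {A : Matrix ι ι ℝ} (hA : A.IsHermitian) (k : ℕ) :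
    trace (A ^ k) = ∑ i, hA.eigenvalues i ^ k := by
  rw [hA.pow_eq_conj, Matrix.trace_mul_comm, ← Matrix.mul_assoc,
    Unitary.coe_star_mul_self, Matrix.one_mul, trace_diagonal]

theorem trace_even_pow_nonneg {A : Matrix ι ι ℝ} (hA : A.IsHermitian) (m : ℕ) :
    0 ≤ trace (A ^ (2 * m)) := by
  rw [hA.trace_pow_eq_sum]
  exact Finset.sum_nonneg fun i _ => (even_two_mul m).pow_nonneg _

theorem norm_pow_le_trace {A : Matrix ι ι ℝ} (hA : A.IsHermitian) {m : ℕ} (hm : m ≠ 0) :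
    ‖A‖ ^ (2 * m) ≤ trace (A ^ (2 * m)) := by
  have hnorm : ‖A‖ = ‖hA.eigenvalues‖ := by
    have h := hA.pow_eq_conj 1
    simp only [pow_one] at h
    rw [← Unitary.coe_star] at h
    have h := congrArg norm h
    rw [CStarRing.norm_mul_coe_unitary, CStarRing.norm_coe_unitary_mul,
      l2_opNorm_diagonal] at h
    exact h
  rw [hnorm, hA.trace_pow_eq_sum]
  rcases isEmpty_or_nonempty ι with h | h
  · simp [Subsingleton.elim hA.eigenvalues 0, hm]
  · obtain ⟨i, hi⟩ := Finite.exists_max fun i => ‖hA.eigenvalues i‖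
    have : ‖hA.eigenvalues‖ ≤ ‖hA.eigenvalues i‖ := (pi_norm_le_iff_of_nonneg (norm_nonneg _)).2 hi
    calc ‖hA.eigenvalues‖ ^ (2 * m) ≤ ‖hA.eigenvalues i‖ ^ (2 * m) := by gcongr
      _ = hA.eigenvalues i ^ (2 * m) := (even_two_mul m).pow_abs _
      _ ≤ _ := Finset.single_le_sum (f := fun i => hA.eigenvalues i ^ (2 * m))
        (fun i _ => (even_two_mul m).pow_nonneg _) (Finset.mem_univ i)

theorem mul_trace_pow_le {A : Matrix ι ι ℝ} (hA : A.IsHermitian) {v : ℝ} (hv : 0 ≤ v) (m : ℕ) :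
    (m + 1) * (v * trace (A ^ (2 * m))) ≤
      Fintype.card ι * v ^ (m + 1) + m * trace (A ^ (2 * (m + 1))) := by
  rw [hA.trace_pow_eq_sum, hA.trace_pow_eq_sum, Finset.mul_sum, Finset.mul_sum, Finset.mul_sum,
    ← nsmul_eq_mul, Fintype.card, ← Finset.sum_const, ← Finset.sum_add_distrib]
  refine Finset.sum_le_sum fun i _ => ?_
  rw [pow_mul, pow_mul]
  exact nat_mul_mul_pow_le hv (sq_nonneg _) m

/-- By cyclicity every trace reduces to words `A ^ a * B ^ b`, so `sub_mul_odd_pow_sub_le` applies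
to each pair of eigenvalues. -/
theorem trace_sub_mul_pow_sub_le {A B : Matrix ι ι ℝ} (hA : A.IsHermitian) (hB : B.IsHermitian)
    (m : ℕ) :
    trace ((A - B) * (A ^ (2 * m + 1) - B ^ (2 * m + 1))) ≤
      (2 * m + 1) / 2 * (trace ((A - B) ^ 2 * A ^ (2 * m)) + trace ((A - B) ^ 2 * B ^ (2 * m))) := by
  have key := trace_pow_mul_pow hA hB
  have hp1 : ∀ C : Matrix ι ι ℝ, C ^ (2 * m + 1) = C * C ^ (2 * m) := fun C => pow_succ' _ _
  have hp2 : ∀ C : Matrix ι ι ℝ, C ^ (2 * m + 2) = C * (C * C ^ (2 * m)) := fun C => by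
    rw [pow_succ', hp1]
  have e1 : trace ((A - B) * (A ^ (2 * m + 1) - B ^ (2 * m + 1))) =
      trace (A ^ (2 * m + 2) * B ^ 0) - trace (A ^ 1 * B ^ (2 * m + 1))
        - trace (A ^ (2 * m + 1) * B ^ 1) + trace (A ^ 0 * B ^ (2 * m + 2)) := by
    rw [Matrix.trace_mul_comm (A ^ (2 * m + 1)) (B ^ 1), ← trace_sub, ← trace_sub, ← trace_add]
    congr 1
    simp only [hp1, hp2]
    noncomm_ring
  have e2 : trace ((A - B) ^ 2 * A ^ (2 * m)) =
      trace (A ^ (2 * m + 2) * B ^ 0) - 2 * trace (A ^ (2 * m + 1) * B ^ 1)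
        + trace (A ^ (2 * m) * B ^ 2) := by
    have : (A - B) ^ 2 * A ^ (2 * m) = A ^ (2 * m + 2) - A * (B * A ^ (2 * m))
      - B * A ^ (2 * m + 1) + B ^ 2 * A ^ (2 * m) := by
      simp only [hp1, hp2]
      noncomm_ring
    rw [this, trace_add, trace_sub, trace_sub, Matrix.trace_mul_comm A, Matrix.mul_assoc, ← pow_succ,
      Matrix.trace_mul_comm (B ^ 2), Matrix.trace_mul_comm B]
    simp only [pow_zero, Matrix.mul_one, pow_one]
    ring
  have e3 : trace ((A - B) ^ 2 * B ^ (2 * m)) =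
      trace (A ^ 0 * B ^ (2 * m + 2)) - 2 * trace (A ^ 1 * B ^ (2 * m + 1))
        + trace (A ^ 2 * B ^ (2 * m)) := by
    have : (A - B) ^ 2 * B ^ (2 * m) = B ^ (2 * m + 2) - A * B ^ (2 * m + 1)
      - B * (A * B ^ (2 * m)) + A ^ 2 * B ^ (2 * m) := by
      simp only [hp1, hp2]
      noncomm_ring
    rw [this, trace_add, trace_sub, trace_sub, Matrix.trace_mul_comm B, Matrix.mul_assoc, ← pow_succ]
    simp only [pow_zero, Matrix.one_mul, pow_one]
    ring
  rw [e1, e2, e3]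
  simp only [key, ← Finset.sum_sub_distrib, ← Finset.sum_add_distrib, Finset.mul_sum]
  refine Finset.sum_le_sum fun i _ => Finset.sum_le_sum fun j _ => ?_
  have h := mul_le_mul_of_nonneg_right
    (sub_mul_odd_pow_sub_le (hA.eigenvalues i) (hB.eigenvalues j) m)
    (sq_nonneg ((star (hA.eigenvectorUnitary : Matrix ι ι ℝ) *
        (hB.eigenvectorUnitary : Matrix ι ι ℝ)) i j))
  refine le_of_eq_of_le ?_ (h.trans_eq ?_) <;> ring

end Matrix.IsHermitian

end Spectral

/-! ### Exchangeable pairs on a finite product space. -/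

section Resampling

variable {ι β κ : Type*}

/-- The weight of a point under the product of the weights `q e`. -/
def prodWeight [Fintype ι] (q : ι → β → ℝ) (x : ι → β) : ℝ := ∏ e, q e (x e)

theorem prodWeight_nonneg [Fintype ι] {q : ι → β → ℝ} (hq : ∀ e b, 0 ≤ q e b) (x : ι → β) :
    0 ≤ prodWeight q x := Finset.prod_nonneg fun e _ => hq e _

variable [DecidableEq ι]

/-- The exchange of coordinate `e` of a point with a free value. -/
def swapCoord (e : ι) : Equiv.Perm ((ι → β) × β) :=
  Function.Involutive.toPerm (fun z => (Function.update z.1 e z.2, z.1 e)) fun z => by simp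

theorem swapCoord_apply (e : ι) (z : (ι → β) × β) :
    swapCoord e z = (Function.update z.1 e z.2, z.1 e) := rfl

theorem prodWeight_update_mul [Fintype ι] (q : ι → β → ℝ) (e : ι) (x : ι → β) (b : β) :
    prodWeight q (Function.update x e b) * q e (x e) = prodWeight q x * q e b := by
  simp only [prodWeight]
  rw [← Finset.mul_prod_erase _ _ (Finset.mem_univ e),
    ← Finset.mul_prod_erase (a := e) _ (fun i => q i (x i)) (Finset.mem_univ e),
    Function.update_self]
  have : ∏ i ∈ Finset.univ.erase e, q i (Function.update x e b i) =
      ∏ i ∈ Finset.univ.erase e, q i (x i) :=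
    Finset.prod_congr rfl fun i hi => by rw [Function.update_of_ne (Finset.ne_of_mem_erase hi)]
  rw [this]
  ring

variable [Fintype ι] [Fintype β]

theorem sum_prodWeight_mul_prod (q : ι → β → ℝ) (g : ι → β → ℝ) :
    ∑ x, prodWeight q x * ∏ e, g e (x e) = ∏ e, ∑ b, q e b * g e b := by
  simp only [prodWeight, ← Finset.prod_mul_distrib]
  rw [Finset.prod_univ_sum, Fintype.piFinset_univ]

/-- Exchangeability: the original point and the point with coordinate `e` resampled can trade roles.
-/
theorem sum_resample_swap (q : ι → β → ℝ) (e : ι) (G : (ι → β) → (ι → β) → β → β → ℝ) :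
    ∑ z : (ι → β) × β, prodWeight q z.1 * q e z.2 *
        G z.1 (Function.update z.1 e z.2) (z.1 e) z.2 =
      ∑ z : (ι → β) × β, prodWeight q z.1 * q e z.2 *
        G (Function.update z.1 e z.2) z.1 z.2 (z.1 e) := by
  rw [← Equiv.sum_comp (swapCoord e)]
  refine Finset.sum_congr rfl fun z _ => ?_
  simp [swapCoord_apply, prodWeight_update_mul]

variable [Fintype κ] [DecidableEq κ]

theorem sum_trace_mul_odd_pow_le {q : ι → β → ℝ} (hq : ∀ e b, 0 ≤ q e b)
    (hq1 : ∀ e, ∑ b, q e b = 1) {Y : ι → β → Matrix κ κ ℝ} (hY : ∀ e b, (Y e b).IsHermitian)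
    (hY0 : ∀ e, ∑ b, q e b • Y e b = 0) (e : ι) (m : ℕ) :
    ∑ x, prodWeight q x * Matrix.trace (Y e (x e) * (∑ f, Y f (x f)) ^ (2 * m + 1)) ≤
      (2 * m + 1) / 2 * ∑ x, prodWeight q x *
        Matrix.trace ((Y e (x e) ^ 2 + ∑ b, q e b • Y e b ^ 2) *
          (∑ f, Y f (x f)) ^ (2 * m)) := by
  set X : (ι → β) → Matrix κ κ ℝ := fun x => ∑ f, Y f (x f) with hX
  have hXh : ∀ x, (X x).IsHermitian := fun x =>
    isSelfAdjoint_sum _ fun f _ => hY f (x f)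
  have hdiff : ∀ x b, X x - X (Function.update x e b) = Y e (x e) - Y e b := by
    intro x b
    simp only [hX, ← Finset.sum_sub_distrib]
    rw [Finset.sum_eq_single e]
    · simp
    · intro f _ hf
      rw [Function.update_of_ne hf, sub_self]
    · simp
  have h1 : ∑ x, prodWeight q x * Matrix.trace (Y e (x e) * X x ^ (2 * m + 1)) =
      ∑ z : (ι → β) × β, prodWeight q z.1 * q e z.2 *
        Matrix.trace ((Y e (z.1 e) - Y e z.2) * X z.1 ^ (2 * m + 1)) := by
    rw [Fintype.sum_prod_type]
    refine Finset.sum_congr rfl fun x _ => ?_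
    simp only [mul_assoc, ← Finset.mul_sum]
    congr 1
    -- Centering makes `Y e (x e)` the average of its difference from an independent copy.
    have : Y e (x e) = ∑ b, q e b • (Y e (x e) - Y e b) := by
      simp only [smul_sub, Finset.sum_sub_distrib, hY0, sub_zero, ← Finset.sum_smul, hq1, one_smul]
    conv_lhs => rw [this]
    simp [Finset.sum_mul, Matrix.trace_sum]
  have h2 := sum_resample_swap q e fun x _ a b =>
    Matrix.trace ((Y e a - Y e b) * X x ^ (2 * m + 1))
  have h3 := sum_resample_swap q e fun x _ a b =>
    Matrix.trace ((Y e a - Y e b) ^ 2 * X x ^ (2 * m))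
  have h4 : ∑ z : (ι → β) × β, prodWeight q z.1 * q e z.2 *
        Matrix.trace ((Y e (z.1 e) - Y e z.2) ^ 2 * X z.1 ^ (2 * m)) =
      ∑ x, prodWeight q x * Matrix.trace ((Y e (x e) ^ 2 + ∑ b, q e b • Y e b ^ 2) *
          X x ^ (2 * m)) := by
    rw [Fintype.sum_prod_type]
    refine Finset.sum_congr rfl fun x _ => ?_
    simp only [mul_assoc, ← Finset.mul_sum]
    congr 1
    have : Y e (x e) ^ 2 + ∑ b, q e b • Y e b ^ 2 =
        ∑ b, q e b • (Y e (x e) - Y e b) ^ 2 := by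
      have hb : ∀ b, q e b • (Y e (x e) - Y e b) ^ 2 = q e b • Y e (x e) ^ 2
          - Y e (x e) * (q e b • Y e b) - (q e b • Y e b) * Y e (x e) + q e b • Y e b ^ 2 := by
        intro b
        rw [mul_smul_comm, smul_mul_assoc, ← smul_sub, ← smul_sub, ← smul_add]
        congr 1
        noncomm_ring
      simp only [hb, Finset.sum_add_distrib, Finset.sum_sub_distrib, ← Finset.mul_sum,
        ← Finset.sum_mul, hY0, mul_zero, zero_mul, sub_zero, ← Finset.sum_smul, hq1, one_smul]
    rw [this]
    simp [Finset.sum_mul, Matrix.trace_sum]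
  have h5 : ∑ z : (ι → β) × β, prodWeight q z.1 * q e z.2 *
        Matrix.trace ((Y e (z.1 e) - Y e z.2) * X z.1 ^ (2 * m + 1)) +
      ∑ z : (ι → β) × β, prodWeight q z.1 * q e z.2 *
        Matrix.trace ((Y e (z.1 e) - Y e z.2) * X z.1 ^ (2 * m + 1)) ≤
      (2 * m + 1) / 2 * (∑ z : (ι → β) × β, prodWeight q z.1 * q e z.2 *
        Matrix.trace ((Y e (z.1 e) - Y e z.2) ^ 2 * X z.1 ^ (2 * m)) +
        ∑ z : (ι → β) × β, prodWeight q z.1 * q e z.2 *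
        Matrix.trace ((Y e (z.1 e) - Y e z.2) ^ 2 * X z.1 ^ (2 * m))) := by
    -- One of the two equal copies is swapped on each side, which produces the symmetric form of the
    -- trace inequality.
    nth_rewrite 2 [h2]
    nth_rewrite 2 [h3]
    rw [← Finset.sum_add_distrib, ← Finset.sum_add_distrib, Finset.mul_sum]
    refine Finset.sum_le_sum fun z _ => ?_
    have h := (hXh z.1).trace_sub_mul_pow_sub_le (hXh (Function.update z.1 e z.2)) m
    rw [hdiff, mul_sub, Matrix.trace_sub] at h
    have h' := mul_le_mul_of_nonneg_left h (mul_nonneg (prodWeight_nonneg hq z.1) (hq e z.2))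
    have e1 : (Y e z.2 - Y e (z.1 e)) = -(Y e (z.1 e) - Y e z.2) := by abel
    rw [e1, neg_mul, neg_sq, Matrix.trace_neg]
    linarith
  rw [h4] at h5
  rw [h1]
  linarith

theorem sum_trace_even_pow_le {q : ι → β → ℝ} (hq : ∀ e b, 0 ≤ q e b)
    (hq1 : ∀ e, ∑ b, q e b = 1) {Y : ι → β → Matrix κ κ ℝ} (hY : ∀ e b, (Y e b).IsHermitian)
    (hY0 : ∀ e, ∑ b, q e b • Y e b = 0) (m : ℕ) :
    ∑ x, prodWeight q x * Matrix.trace ((∑ f, Y f (x f)) ^ (2 * (m + 1))) ≤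
      (2 * m + 1) / 2 * ∑ x, prodWeight q x *
        Matrix.trace ((∑ e, (Y e (x e) ^ 2 + ∑ b, q e b • Y e b ^ 2)) *
          (∑ f, Y f (x f)) ^ (2 * m)) := by
  have h := Finset.sum_le_sum fun e (_ : e ∈ Finset.univ) =>
    sum_trace_mul_odd_pow_le hq hq1 hY hY0 e m
  rw [← Finset.mul_sum, Finset.sum_comm, Finset.sum_comm (s := Finset.univ (α := ι))] at h
  refine le_of_eq_of_le ?_ (h.trans_eq ?_)
  · refine Finset.sum_congr rfl fun x _ => ?_
    rw [← Finset.mul_sum, ← Matrix.trace_sum, ← Finset.sum_mul, ← pow_succ']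
    rfl
  · congr 1
    refine Finset.sum_congr rfl fun x _ => ?_
    rw [← Finset.mul_sum, ← Matrix.trace_sum, ← Finset.sum_mul]

end Resampling

/-! ### Edge decomposition of the Laplacian and degree bounds. -/

section EdgeLaplacian

variable {n : ℕ}

/-- The pairs `i ≤ j` that index the independent entries of a symmetric matrix. -/
abbrev EdgeIndex (n : ℕ) : Type := {e : Fin n × Fin n // e.1 ≤ e.2}

/-- The signed incidence vector of an edge; it vanishes for a self-loop. -/
def EdgeIndex.incVec (e : EdgeIndex n) : Fin n → ℝ :=
  Pi.single e.1.1 1 - Pi.single e.1.2 1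

/-- The Laplacian matrix of a single edge of weight one. -/
def EdgeIndex.laplacian (e : EdgeIndex n) : Matrix (Fin n) (Fin n) ℝ :=
  Matrix.vecMulVec e.incVec e.incVec

theorem sum_edgeIndex_add_self {f : Fin n → Fin n → ℝ} (hf : ∀ i j, f i j = f j i)
    (h0 : ∀ i, f i i = 0) :
    ∑ e : EdgeIndex n, f e.1.1 e.1.2 + ∑ e : EdgeIndex n, f e.1.1 e.1.2 = ∑ i, ∑ j, f i j := by
  have h : ∑ e : EdgeIndex n, f e.1.1 e.1.2 = ∑ i, ∑ j, if i ≤ j then f i j else 0 := by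
    rw [← Fintype.sum_prod_type' (f := fun i j => if i ≤ j then f i j else 0),
      ← Finset.sum_filter]
    exact (Finset.sum_subtype _ (by simp) fun e : Fin n × Fin n => f e.1 e.2).symm
  rw [h]
  nth_rewrite 2 [Finset.sum_comm]
  simp only [← Finset.sum_add_distrib]
  refine Finset.sum_congr rfl fun i _ => Finset.sum_congr rfl fun j _ => ?_
  rcases lt_trichotomy i j with hij | rfl | hij
  · simp [hij.le, hij.not_ge]
  · simp [h0]
  · simp [hij.le, hij.not_ge, hf i j]

theorem weightedLaplacian_eq_sum {M : Matrix (Fin n) (Fin n) ℝ} (hM : ∀ i j, M j i = M i j) :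
    weightedLaplacian M = ∑ e : EdgeIndex n, M e.1.1 e.1.2 • e.laplacian := by
  ext k l
  -- Ordered pairs count every edge twice; loops contribute nothing.
  have h := sum_edgeIndex_add_self (f := fun i j => M i j *
    (((Pi.single i 1 : Fin n → ℝ) k - (Pi.single j 1 : Fin n → ℝ) k) *
      ((Pi.single i 1 : Fin n → ℝ) l - (Pi.single j 1 : Fin n → ℝ) l)))
    (fun i j => by rw [hM]; ring) (fun i => by ring)
  have h1 : ∑ i, ∑ j, M i j *
      (((Pi.single i 1 : Fin n → ℝ) k - (Pi.single j 1 : Fin n → ℝ) k) *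
      ((Pi.single i 1 : Fin n → ℝ) l - (Pi.single j 1 : Fin n → ℝ) l)) =
      2 * weightedLaplacian M k l := by
    simp only [weightedLaplacian, Matrix.sub_apply, Matrix.diagonal_apply, Pi.single_apply,
      mul_sub, Finset.sum_sub_distrib, mul_ite, mul_one, mul_zero, Finset.sum_ite_eq,
      Finset.mem_univ, if_true]
    by_cases hkl : k = l
    · subst hkl
      simp [hM, Finset.sum_ite_eq]
      ring
    · simp [hkl, hM l k]
      ring
  rw [h1] at h
  rw [Matrix.sum_apply]
  simp only [Matrix.smul_apply, EdgeIndex.laplacian, Matrix.vecMulVec_apply, EdgeIndex.incVec,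
    Pi.sub_apply, smul_eq_mul]
  linarith

theorem EdgeIndex.isHermitian_laplacian (e : EdgeIndex n) : e.laplacian.IsHermitian := by
  ext i j
  simp [laplacian, Matrix.vecMulVec_apply, mul_comm]

theorem EdgeIndex.laplacian_sq (e : EdgeIndex n) : e.laplacian ^ 2 = (2 : ℝ) • e.laplacian := by
  rcases eq_or_ne e.1.1 e.1.2 with h | h
  · simp [laplacian, incVec, h]
  · have : e.incVec ⬝ᵥ e.incVec = 2 := by
      simp [incVec, h, h.symm]
      norm_num
    rw [sq, laplacian, Matrix.vecMulVec_mul_vecMulVec, this, Matrix.vecMulVec_smul]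

theorem EdgeIndex.laplacian_apply_self_mem (e : EdgeIndex n) (k : Fin n) :
    e.laplacian k k ∈ Set.Icc (0 : ℝ) 1 := by
  simp only [laplacian, incVec, Matrix.vecMulVec_apply, Pi.sub_apply, Pi.single_apply]
  split_ifs <;> simp

theorem EdgeIndex.sq_dotProduct_incVec_le (e : EdgeIndex n) (m : Fin n → ℝ) :
    (e.incVec ⬝ᵥ m) ^ 2 ≤ 2 * ∑ k, e.laplacian k k * m k ^ 2 := by
  rcases eq_or_ne e.1.1 e.1.2 with h | h
  · simp [laplacian, incVec, h]
  · have h1 : e.incVec ⬝ᵥ m = m e.1.1 - m e.1.2 := by simp [incVec, sub_dotProduct]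
    have h2 : ∑ k, e.laplacian k k * m k ^ 2 = m e.1.1 ^ 2 + m e.1.2 ^ 2 := by
      simp only [laplacian, incVec, Matrix.vecMulVec_apply, Pi.sub_apply, Pi.single_apply,
        mul_sub, sub_mul, Finset.sum_sub_distrib, ite_mul, mul_ite, mul_one, mul_zero, one_mul,
        zero_mul, Finset.sum_ite_eq', Finset.mem_univ, if_true]
      simp [h, h.symm]
    rw [h1, h2]
    nlinarith [sq_nonneg (m e.1.1 + m e.1.2)]

theorem EdgeIndex.trace_laplacian_mul_le (e : EdgeIndex n) (M : Matrix (Fin n) (Fin n) ℝ) :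
    Matrix.trace (e.laplacian * (M * M.transpose)) ≤
      2 * ∑ k, e.laplacian k k * (M * M.transpose) k k := by
  have h1 : Matrix.trace (e.laplacian * (M * M.transpose)) =
      ∑ l, (e.incVec ⬝ᵥ fun k => M k l) ^ 2 := by
    rw [laplacian, Matrix.vecMulVec_mul, Matrix.trace_vecMulVec, ← Matrix.vecMul_vecMul,
      Matrix.vecMul_transpose, Matrix.dotProduct_mulVec]
    exact Finset.sum_congr rfl fun l _ => (sq _).symm
  have h2 : ∑ k, e.laplacian k k * (M * M.transpose) k k =
      ∑ l, ∑ k, e.laplacian k k * M k l ^ 2 := by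
    rw [Finset.sum_comm]
    refine Finset.sum_congr rfl fun k _ => ?_
    rw [Matrix.mul_apply, Finset.mul_sum]
    exact Finset.sum_congr rfl fun l _ => by rw [Matrix.transpose_apply, sq]
  rw [h1, h2, Finset.mul_sum]
  exact Finset.sum_le_sum fun l _ => e.sq_dotProduct_incVec_le _

/-- Trace form of "Laplacian ≤ 2 · degree matrix", which comes from `(a - b) ^ 2 ≤ 2 (a ^ 2 + b ^
2)` on each edge. The factor `M * M.transpose` plays the role of an even power of `X`. -/
theorem sum_mul_trace_laplacian_le {c : EdgeIndex n → ℝ} (hc : ∀ e, 0 ≤ c e) {D : ℝ}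
    (hD : ∀ k, ∑ e : EdgeIndex n, e.laplacian k k * c e ≤ D) (M : Matrix (Fin n) (Fin n) ℝ) :
    ∑ e, c e * Matrix.trace (e.laplacian * (M * M.transpose)) ≤
      2 * D * Matrix.trace (M * M.transpose) := by
  calc ∑ e, c e * Matrix.trace (e.laplacian * (M * M.transpose))
      ≤ ∑ e : EdgeIndex n, c e * (2 * ∑ k, e.laplacian k k * (M * M.transpose) k k) :=
        Finset.sum_le_sum fun e _ => mul_le_mul_of_nonneg_left (e.trace_laplacian_mul_le M) (hc e)
    _ = ∑ k, 2 * (∑ e : EdgeIndex n, e.laplacian k k * c e) * (M * M.transpose) k k := by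
        simp only [Finset.mul_sum, Finset.sum_mul]
        rw [Finset.sum_comm]
        exact Finset.sum_congr rfl fun k _ => Finset.sum_congr rfl fun e _ => by ring
    _ ≤ ∑ k, 2 * D * (M * M.transpose) k k := by
        refine Finset.sum_le_sum fun k _ => mul_le_mul_of_nonneg_right (by linarith [hD k]) ?_
        rw [Matrix.mul_apply]
        exact Finset.sum_nonneg fun l _ => mul_self_nonneg _
    _ = 2 * D * Matrix.trace (M * M.transpose) := by rw [← Finset.mul_sum]; rfl

theorem sum_edgeIndex_laplacian_apply_self_le {M : Matrix (Fin n) (Fin n) ℝ}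
    (hM : ∀ i j, M j i = M i j) (h0 : ∀ i, 0 ≤ M i i) (k : Fin n) :
    ∑ e : EdgeIndex n, e.laplacian k k * M e.1.1 e.1.2 ≤ ∑ j, M k j := by
  have h := congrFun (congrFun (weightedLaplacian_eq_sum hM) k) k
  rw [Matrix.sum_apply] at h
  simp only [weightedLaplacian, Matrix.sub_apply, Matrix.diagonal_apply_eq, Matrix.smul_apply,
    smul_eq_mul] at h
  simp only [mul_comm (EdgeIndex.laplacian _ k k)]
  linarith [h0 k]

end EdgeLaplacian

/-! ### Moments of sums of independent variables in `[0, 1]`. -/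

section Moments

variable {ι β : Type*} [Fintype ι] [DecidableEq ι] [Fintype β]

theorem pow_le_mul_exp {d K : ℝ} (hd : 0 ≤ d) (hK : 0 < K) (p : ℕ) :
    d ^ p ≤ K ^ p * Real.exp (p / K * d - p) := by
  have h : d ≤ K * Real.exp (d / K - 1) := by
    have := Real.add_one_le_exp (d / K - 1)
    rw [sub_add_cancel, div_le_iff₀ hK] at this
    linarith
  calc d ^ p ≤ (K * Real.exp (d / K - 1)) ^ p := by gcongr
    _ = K ^ p * Real.exp (p / K * d - p) := by
      rw [mul_pow, ← Real.exp_nat_mul]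
      congr 2
      field_simp

theorem exp_mul_le_one_add {s z : ℝ} (hs : 0 ≤ s) (hs1 : s ≤ 1 / 4) (hz : z ∈ Set.Icc (0 : ℝ) 1) :
    Real.exp (s * z) ≤ 1 + 5 / 4 * s * z := by
  obtain ⟨h0, h1⟩ := hz
  have hsz : 0 ≤ s * z := mul_nonneg hs h0
  have hle : s * z ≤ 1 / 4 := by nlinarith
  have h := (abs_le.1 (Real.abs_exp_sub_one_sub_id_le (x := s * z)
    (by rw [abs_of_nonneg hsz]; linarith))).2
  nlinarith

/-- The power is dominated by an exponential tangent at `K = 9/4 * D`, with rate `s = p / K ≤ 1/4`.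
The random part contributes `5/4 * s * D` to the exponent and the added mean `s * D`; the total `9/4
* s * D = p` cancels `exp (-p)`. -/
theorem sum_prodWeight_mul_pow_le {q : ι → β → ℝ} (hq : ∀ e b, 0 ≤ q e b)
    (hq1 : ∀ e, ∑ b, q e b = 1) {Z : ι → β → ℝ} (hZ : ∀ e b, Z e b ∈ Set.Icc (0 : ℝ) 1)
    {D : ℝ} (hD : 0 < D) (hmean : ∑ e, ∑ b, q e b * Z e b ≤ D) {p : ℕ} (hp : (p : ℝ) ≤ 9 / 16 * D) :
    ∑ x, prodWeight q x * (∑ e, (Z e (x e) + ∑ b, q e b * Z e b)) ^ p ≤ (9 / 4 * D) ^ p := by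
  set K := 9 / 4 * D with hK
  have hKpos : 0 < K := by positivity
  set s := p / K with hs
  have hs0 : 0 ≤ s := by positivity
  have hs1 : s ≤ 1 / 4 := by rw [hs, div_le_iff₀ hKpos]; linarith
  have hsD : 9 / 4 * s * D = p := by rw [hs, hK]; field_simp
  set v := fun e => ∑ b, q e b * Z e b with hv
  have hv0 : ∀ e, 0 ≤ v e := fun e => Finset.sum_nonneg fun b _ => mul_nonneg (hq e b) (hZ e b).1
  have hfactor : ∀ e, ∑ b, q e b * Real.exp (s * (Z e b + v e)) ≤ Real.exp (9 / 4 * s * v e) := by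
    intro e
    have h1 : ∑ b, q e b * Real.exp (s * Z e b) ≤ Real.exp (5 / 4 * s * v e) := by
      calc ∑ b, q e b * Real.exp (s * Z e b) ≤ ∑ b, q e b * (1 + 5 / 4 * s * Z e b) :=
            Finset.sum_le_sum fun b _ => mul_le_mul_of_nonneg_left
              (exp_mul_le_one_add hs0 hs1 (hZ e b)) (hq e b)
        _ = 5 / 4 * s * v e + 1 := by
            simp only [mul_add, mul_one, Finset.sum_add_distrib, hq1, hv, Finset.mul_sum]
            rw [add_comm]
            congr 1
            exact Finset.sum_congr rfl fun b _ => by ring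
        _ ≤ _ := Real.add_one_le_exp _
    have h2 : ∑ b, q e b * Real.exp (s * (Z e b + v e)) =
        (∑ b, q e b * Real.exp (s * Z e b)) * Real.exp (s * v e) := by
      rw [Finset.sum_mul]
      exact Finset.sum_congr rfl fun b _ => by rw [mul_add, Real.exp_add, mul_assoc]
    rw [h2]
    refine (mul_le_mul_of_nonneg_right h1 (Real.exp_pos _).le).trans_eq ?_
    rw [← Real.exp_add]
    congr 1
    ring
  calc ∑ x, prodWeight q x * (∑ e, (Z e (x e) + v e)) ^ p
      ≤ ∑ x, prodWeight q x * (K ^ p * Real.exp (s * (∑ e, (Z e (x e) + v e)) - p)) :=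
        Finset.sum_le_sum fun x _ => mul_le_mul_of_nonneg_left
          (pow_le_mul_exp (Finset.sum_nonneg fun e _ => add_nonneg (hZ e _).1 (hv0 e)) hKpos p)
          (prodWeight_nonneg hq x)
    _ = K ^ p * Real.exp (-p) *
          ∑ x, prodWeight q x * ∏ e, Real.exp (s * (Z e (x e) + v e)) := by
        rw [Finset.mul_sum]
        refine Finset.sum_congr rfl fun x _ => ?_
        rw [← Real.exp_sum, ← Finset.mul_sum, sub_eq_add_neg, Real.exp_add]
        ring
    _ = K ^ p * Real.exp (-p) * ∏ e, ∑ b, q e b * Real.exp (s * (Z e b + v e)) := by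
        rw [sum_prodWeight_mul_prod q fun e b => Real.exp (s * (Z e b + v e))]
    _ ≤ K ^ p * Real.exp (-p) * ∏ e, Real.exp (9 / 4 * s * v e) := by
        refine mul_le_mul_of_nonneg_left (Finset.prod_le_prod (fun e _ => ?_) fun e _ => hfactor e)
          (by positivity)
        exact Finset.sum_nonneg fun b _ => mul_nonneg (hq e b) (Real.exp_pos _).le
    _ = K ^ p * Real.exp (9 / 4 * s * ∑ e, v e - p) := by
        rw [← Real.exp_sum, ← Finset.mul_sum, sub_eq_add_neg, Real.exp_add]
        ring
    _ ≤ K ^ p * 1 := by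
        refine mul_le_mul_of_nonneg_left (Real.exp_le_one_iff.2 ?_) (by positivity)
        have := mul_le_mul_of_nonneg_left hmean (by positivity : 0 ≤ 9 / 4 * s)
        linarith
    _ = K ^ p := mul_one _

end Moments

/-! ### Trace moments and tail of the centered Laplacian. -/

section RandomLaplacian

variable {n : ℕ} {β : Type*} [Fintype β]

/-- Young's inequality bounds `m + 1` copies of the moment by the degree term plus `m` copies of the
same moment; subtracting leaves one. -/
theorem sum_trace_laplacian_even_pow_le (hn : 0 < n) {q : EdgeIndex n → β → ℝ}
    (hq : ∀ e b, 0 ≤ q e b) (hq1 : ∀ e, ∑ b, q e b = 1) {y : EdgeIndex n → β → ℝ}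
    (hy0 : ∀ e, ∑ b, q e b * y e b = 0) (m : ℕ) :
    ∑ x, prodWeight q x * Matrix.trace ((∑ e, y e (x e) • e.laplacian) ^ (2 * (m + 1))) ≤
      n * ∑ k, ∑ x, prodWeight q x * (2 * (2 * m + 1) *
        ∑ e, (e.laplacian k k * y e (x e) ^ 2 +
          ∑ b, q e b * (e.laplacian k k * y e b ^ 2))) ^ (m + 1) := by
  set Y : EdgeIndex n → β → Matrix (Fin n) (Fin n) ℝ := fun e b => y e b • e.laplacian with hYdef
  have hY : ∀ e b, (Y e b).IsHermitian := fun e b => by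
    simp only [hYdef, Matrix.IsHermitian, Matrix.conjTranspose_smul, star_trivial,
      e.isHermitian_laplacian.eq]
  set X : (EdgeIndex n → β) → Matrix (Fin n) (Fin n) ℝ := fun x => ∑ e, Y e (x e) with hX
  have hXh : ∀ x, (X x).IsHermitian := fun x => isSelfAdjoint_sum _ fun f _ => hY f (x f)
  have hY0 : ∀ e, ∑ b, q e b • Y e b = 0 := fun e => by
    simp only [hYdef, smul_smul, ← Finset.sum_smul, hy0, zero_smul]
  set c : (EdgeIndex n → β) → EdgeIndex n → ℝ :=
    fun x e => y e (x e) ^ 2 + ∑ b, q e b * y e b ^ 2 with hc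
  have hc0 : ∀ x e, 0 ≤ c x e := fun x e =>
    add_nonneg (sq_nonneg _) (Finset.sum_nonneg fun b _ => mul_nonneg (hq e b) (sq_nonneg _))
  set d : (EdgeIndex n → β) → Fin n → ℝ := fun x k => ∑ e : EdgeIndex n, e.laplacian k k * c x e
    with hd
  have hd0 : ∀ x k, 0 ≤ d x k := fun x k => Finset.sum_nonneg fun e _ =>
    mul_nonneg (e.laplacian_apply_self_mem k).1 (hc0 x e)
  have hdeq : ∀ x k, ∑ e : EdgeIndex n, (e.laplacian k k * y e (x e) ^ 2 +
      ∑ b, q e b * (e.laplacian k k * y e b ^ 2)) = d x k := fun x k => by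
    refine Finset.sum_congr rfl fun e _ => ?_
    rw [hc, mul_add, Finset.mul_sum]
    congr 1
    exact Finset.sum_congr rfl fun b _ => by ring
  simp only [hdeq]
  have hV : ∀ x, ∑ e, (Y e (x e) ^ 2 + ∑ b, q e b • Y e b ^ 2) =
      ∑ e : EdgeIndex n, (2 * c x e) • e.laplacian := fun x => by
    refine Finset.sum_congr rfl fun e _ => ?_
    simp only [hYdef, smul_pow, e.laplacian_sq, smul_smul, ← Finset.sum_smul, ← add_smul, hc]
    congr 1
    rw [mul_add, Finset.mul_sum, mul_comm]
    congr 1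
    exact Finset.sum_congr rfl fun b _ => by ring
  have hpoint : ∀ x, (m + 1) * ((2 * m + 1) / 2 * Matrix.trace
      ((∑ e, (Y e (x e) ^ 2 + ∑ b, q e b • Y e b ^ 2)) * X x ^ (2 * m))) ≤
      n * ∑ k, (2 * (2 * m + 1) * d x k) ^ (m + 1) +
        m * Matrix.trace (X x ^ (2 * (m + 1))) := by
    intro x
    have : Nonempty (Fin n) := ⟨⟨0, hn⟩⟩
    -- The vertex of largest degree depends on `x`, so the maximum is later replaced by a sum over
    -- `k`, at the cost of a factor `n`.
    obtain ⟨k₀, hk₀⟩ := Finite.exists_max (d x)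
    have hsq : X x ^ (2 * m) = X x ^ m * (X x ^ m).transpose := by
      have ht : (X x).transpose = X x := by
        simpa [Matrix.conjTranspose_eq_transpose_of_trivial] using (hXh x).eq
      rw [Matrix.transpose_pow, ht, ← pow_add, two_mul]
    have h1 := sum_mul_trace_laplacian_le (hc0 x) hk₀ (X x ^ m)
    rw [← hsq] at h1
    have h2 : Matrix.trace ((∑ e, (Y e (x e) ^ 2 + ∑ b, q e b • Y e b ^ 2)) * X x ^ (2 * m)) =
        2 * ∑ e : EdgeIndex n, c x e * Matrix.trace (e.laplacian * X x ^ (2 * m)) := by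
      rw [hV, Finset.sum_mul, Matrix.trace_sum, Finset.mul_sum]
      refine Finset.sum_congr rfl fun e _ => ?_
      rw [smul_mul_assoc, Matrix.trace_smul, smul_eq_mul, mul_assoc]
    have hv0 : 0 ≤ 2 * (2 * m + 1) * d x k₀ := by have := hd0 x k₀; positivity
    have h3 := (hXh x).mul_trace_pow_le hv0 m
    rw [Fintype.card_fin] at h3
    have h4 : (2 * (2 * m + 1) * d x k₀) ^ (m + 1) ≤
        ∑ k, (2 * (2 * m + 1) * d x k) ^ (m + 1) :=
      Finset.single_le_sum (f := fun k => (2 * (2 * m + 1) * d x k) ^ (m + 1))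
        (fun k _ => by have := hd0 x k; positivity) (Finset.mem_univ k₀)
    rw [h2]
    calc _ ≤ (m + 1) * ((2 * (2 * m + 1) * d x k₀) * Matrix.trace (X x ^ (2 * m))) := by
          refine mul_le_mul_of_nonneg_left ?_ (by positivity)
          have := mul_le_mul_of_nonneg_left h1 (by positivity : (0 : ℝ) ≤ 2 * m + 1)
          linarith
      _ ≤ _ := h3
      _ ≤ _ := by gcongr
  have hmain := sum_trace_even_pow_le hq hq1 hY hY0 m
  have hsum : (m + 1) * ((2 * m + 1) / 2 * ∑ x, prodWeight q x * Matrix.trace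
      ((∑ e, (Y e (x e) ^ 2 + ∑ b, q e b • Y e b ^ 2)) * X x ^ (2 * m))) ≤
      n * ∑ k, ∑ x, prodWeight q x * (2 * (2 * m + 1) * d x k) ^ (m + 1) +
        m * ∑ x, prodWeight q x * Matrix.trace (X x ^ (2 * (m + 1))) := by
    rw [Finset.sum_comm (s := Finset.univ (α := Fin n))]
    simp only [Finset.mul_sum, ← Finset.sum_add_distrib]
    refine Finset.sum_le_sum fun x _ => ?_
    have h := mul_le_mul_of_nonneg_left (hpoint x) (prodWeight_nonneg hq x)
    simp only [Finset.mul_sum, mul_add] at h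
    refine le_of_eq_of_le ?_ (h.trans_eq ?_)
    · ring
    · congr 1
      · exact Finset.sum_congr rfl fun k _ => by ring
      · ring_nf
  have := mul_le_mul_of_nonneg_left hmain (by positivity : (0 : ℝ) ≤ m + 1)
  linarith

theorem sum_prodWeight_norm_laplacian_gt_le (hn : 0 < n) {q : EdgeIndex n → β → ℝ}
    (hq : ∀ e b, 0 ≤ q e b) (hq1 : ∀ e, ∑ b, q e b = 1) {y : EdgeIndex n → β → ℝ}
    (hy0 : ∀ e, ∑ b, q e b * y e b = 0) (hy1 : ∀ e b, |y e b| ≤ 1) {D : ℝ} (hD : 0 < D)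
    (hvar : ∀ k, ∑ e : EdgeIndex n, e.laplacian k k * ∑ b, q e b * y e b ^ 2 ≤ D)
    {l : ℝ} (hl : 2 ≤ l) (hlD : 16 * l ≤ D) :
    ∑ x with 8 * √(D * l) < ‖∑ e, y e (x e) • e.laplacian‖, prodWeight q x ≤
      n ^ 2 * Real.exp (-(2 * l)) := by
  -- `m + 1 = ⌈2 * l⌉`; the upper bound uses `1 ≤ l / 2`.
  obtain ⟨m, hm1, hm2⟩ : ∃ m : ℕ, 2 * l ≤ m + 1 ∧ (m : ℝ) + 1 ≤ 5 / 2 * l := by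
    refine ⟨⌈2 * l⌉₊ - 1, ?_⟩
    have hpos : 1 ≤ ⌈2 * l⌉₊ := Nat.one_le_ceil_iff.2 (by linarith)
    rw [Nat.cast_sub hpos, Nat.cast_one, sub_add_cancel]
    exact ⟨Nat.le_ceil _, by have := Nat.ceil_lt_add_one (by linarith : 0 ≤ 2 * l); linarith⟩
  set X : (EdgeIndex n → β) → Matrix (Fin n) (Fin n) ℝ := fun x => ∑ e, y e (x e) • e.laplacian
  have hXh : ∀ x, (X x).IsHermitian := fun x => isSelfAdjoint_sum _ fun e _ => by
    rw [← Matrix.isHermitian_iff_isSelfAdjoint, Matrix.IsHermitian, Matrix.conjTranspose_smul,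
      star_trivial, e.isHermitian_laplacian.eq]
  have hmom : ∑ x, prodWeight q x * Matrix.trace (X x ^ (2 * (m + 1))) ≤
      n ^ 2 * (9 * (m + 1) * D) ^ (m + 1) := by
    refine (sum_trace_laplacian_even_pow_le hn hq hq1 hy0 m).trans ?_
    have hk : ∀ k, ∑ x, prodWeight q x * (2 * (2 * m + 1) *
        ∑ e : EdgeIndex n, (e.laplacian k k * y e (x e) ^ 2 +
          ∑ b, q e b * (e.laplacian k k * y e b ^ 2))) ^ (m + 1) ≤
        (9 * (m + 1) * D) ^ (m + 1) := by
      intro k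
      have h := sum_prodWeight_mul_pow_le hq hq1
        (Z := fun e b => e.laplacian k k * y e b ^ 2) (D := D) (p := m + 1)
        (fun e b => ⟨mul_nonneg (e.laplacian_apply_self_mem k).1 (sq_nonneg _),
          mul_le_one₀ (e.laplacian_apply_self_mem k).2 (sq_nonneg _)
            ((sq_le_one_iff_abs_le_one _).2 (hy1 e b))⟩) hD
        (by
          refine le_of_eq_of_le (Finset.sum_congr rfl fun e _ => ?_) (hvar k)
          rw [Finset.mul_sum]
          exact Finset.sum_congr rfl fun b _ => by ring)
        (by push_cast; linarith)
      have h' := mul_le_mul_of_nonneg_left h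
        (by positivity : (0 : ℝ) ≤ (2 * (2 * m + 1)) ^ (m + 1))
      rw [← mul_pow, Finset.mul_sum] at h'
      refine le_of_eq_of_le (Finset.sum_congr rfl fun x _ => ?_) (h'.trans ?_)
      · rw [mul_pow]; ring
      -- `2 (2m + 1) * 9/4 ≤ 9 (m + 1)`.
      · refine pow_le_pow_left₀ (by positivity) ?_ _
        nlinarith
    calc _ ≤ (n : ℝ) * ∑ _k : Fin n, (9 * (m + 1) * D) ^ (m + 1) :=
          mul_le_mul_of_nonneg_left (Finset.sum_le_sum fun k _ => hk k) (Nat.cast_nonneg n)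
      _ = _ := by rw [Finset.sum_const, Finset.card_univ, Fintype.card_fin, nsmul_eq_mul]; ring
  have hDl : 0 < D * l := by positivity
  have hmarkov : (64 * (D * l)) ^ (m + 1) *
      ∑ x with 8 * √(D * l) < ‖X x‖, prodWeight q x ≤
      ∑ x, prodWeight q x * Matrix.trace (X x ^ (2 * (m + 1))) := by
    rw [Finset.mul_sum]
    refine (Finset.sum_le_sum fun x hx => ?_).trans (Finset.sum_le_univ_sum_of_nonneg fun x =>
      mul_nonneg (prodWeight_nonneg hq x) ((hXh x).trace_even_pow_nonneg _))
    rw [mul_comm]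
    refine mul_le_mul_of_nonneg_left ?_ (prodWeight_nonneg hq x)
    refine le_trans ?_ ((hXh x).norm_pow_le_trace m.succ_ne_zero)
    have h64 : 64 * (D * l) = (8 * √(D * l)) ^ 2 := by
      rw [mul_pow, Real.sq_sqrt hDl.le]; norm_num
    rw [h64, ← pow_mul]
    exact pow_le_pow_left₀ (by positivity) (Finset.mem_filter.1 hx).2.le _
  have hratio : (9 * (m + 1) * D) ^ (m + 1) ≤ (64 * (D * l)) ^ (m + 1) * Real.exp (-(2 * l)) := by
    -- The constant 8 is settled here: `9 * 5/2 = 22.5 ≤ 64 * 0.36 = 23.04`, so each of the `m + 1`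
    -- factors gains `exp (-1)`.
    have he : (0.36 : ℝ) ≤ Real.exp (-1) := by
      rw [Real.exp_neg, le_inv_comm₀ (by norm_num) (Real.exp_pos _)]
      exact Real.exp_one_lt_d9.le.trans (by norm_num)
    have hbase : 9 * (m + 1) * D ≤ 64 * (D * l) * Real.exp (-1) := by
      calc 9 * (m + 1) * D ≤ 9 * (5 / 2 * l) * D := by gcongr
        _ ≤ 64 * (D * l) * 0.36 := by nlinarith
        _ ≤ _ := by gcongr
    calc (9 * (m + 1) * D) ^ (m + 1) ≤ (64 * (D * l) * Real.exp (-1)) ^ (m + 1) := by gcongr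
      _ = (64 * (D * l)) ^ (m + 1) * Real.exp (-((m : ℝ) + 1)) := by
          rw [mul_pow, ← Real.exp_nat_mul]; push_cast; ring_nf
      _ ≤ _ := by gcongr
  have hfinal := hmarkov.trans (hmom.trans (mul_le_mul_of_nonneg_left hratio (by positivity)))
  refine le_of_mul_le_mul_left (hfinal.trans_eq ?_) (by positivity : 0 < (64 * (D * l)) ^ (m + 1))
  ring

end RandomLaplacian

/-! ### Bernoulli laws as finite weights. -/

section Transfer

/-- The weights of a Bernoulli variable with success probability `p`. -/
def bernoulliWeight (p : ℝ) (b : Bool) : ℝ := if b then p else 1 - p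

theorem bernoulliWeight_nonneg {p : ℝ} (hp : p ∈ Set.Icc (0 : ℝ) 1) (b : Bool) :
    0 ≤ bernoulliWeight p b := by
  cases b
  · simpa [bernoulliWeight] using hp.2
  · simpa [bernoulliWeight] using hp.1

theorem sum_bernoulliWeight (p : ℝ) : ∑ b, bernoulliWeight p b = 1 := by
  simp [bernoulliWeight]

/-- The Bernoulli law with success probability `p`. -/
noncomputable def bernoulliLaw (p : ℝ) : Measure Bool :=
  ENNReal.ofReal p • Measure.dirac true + ENNReal.ofReal (1 - p) • Measure.dirac false

theorem isProbabilityMeasure_bernoulliLaw {p : ℝ} (hp : p ∈ Set.Icc (0 : ℝ) 1) :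
    IsProbabilityMeasure (bernoulliLaw p) := by
  constructor
  simp only [bernoulliLaw, Measure.add_apply, Measure.smul_apply, measure_univ, smul_eq_mul,
    mul_one]
  rw [← ENNReal.ofReal_add hp.1 (sub_nonneg.2 hp.2), add_sub_cancel, ENNReal.ofReal_one]

theorem bernoulliLaw_real_singleton {p : ℝ} (hp : p ∈ Set.Icc (0 : ℝ) 1) (b : Bool) :
    (bernoulliLaw p).real {b} = bernoulliWeight p b := by
  cases b
  · simp [bernoulliLaw, bernoulliWeight, Measure.real, hp.2]
  · simp [bernoulliLaw, bernoulliWeight, Measure.real, hp.1]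

theorem map_bernoulliLaw (p w : ℝ) :
    (bernoulliLaw p).map (fun b => if b then w else 0) =
      ENNReal.ofReal p • Measure.dirac w + ENNReal.ofReal (1 - p) • Measure.dirac (0 : ℝ) := by
  rw [bernoulliLaw, Measure.map_add _ _ (measurable_of_countable _), Measure.map_smul,
    Measure.map_smul, Measure.map_dirac, Measure.map_dirac]
  simp

theorem integral_bernoulli {p : ℝ} (hp : p ∈ Set.Icc (0 : ℝ) 1) (w : ℝ) :
    ∫ a, a ∂(ENNReal.ofReal p • Measure.dirac w +
      ENNReal.ofReal (1 - p) • Measure.dirac (0 : ℝ)) = p * w := by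
  rw [integral_add_measure ((integrable_dirac (by simp)).smul_measure (by simp))
    ((integrable_dirac (by simp)).smul_measure (by simp)), integral_smul_measure,
    integral_smul_measure, integral_dirac, integral_dirac]
  simp [hp.1]

theorem measureReal_pi_bernoulliLaw {ι : Type*} [Fintype ι] {p : ι → ℝ}
    (hp : ∀ e, p e ∈ Set.Icc (0 : ℝ) 1) (s : Finset (ι → Bool)) :
    (Measure.pi fun e => bernoulliLaw (p e)).real s =
      ∑ x ∈ s, prodWeight (fun e => bernoulliWeight (p e)) x := by
  have : ∀ e, IsProbabilityMeasure (bernoulliLaw (p e)) := fun e =>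
    isProbabilityMeasure_bernoulliLaw (hp e)
  rw [← sum_measureReal_singleton]
  refine Finset.sum_congr rfl fun x _ => ?_
  rw [Measure.real, Measure.pi_singleton, ENNReal.toReal_prod]
  exact Finset.prod_congr rfl fun e _ => bernoulliLaw_real_singleton (hp e) (x e)

end Transfer

/-! ### Transfer from the random graph to the Boolean cube. -/

section RandomGraph

variable {n : ℕ} {Ω : Type*} [MeasurableSpace Ω] {μ : Measure Ω}
  {W P : Matrix (Fin n) (Fin n) ℝ} {A : Ω → Matrix (Fin n) (Fin n) ℝ}

namespace IsIndepEdgeWeightedGraph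

theorem expectedMatrix_symm (hA : IsIndepEdgeWeightedGraph μ W P A) (i j : Fin n) :
    expectedMatrix μ A j i = expectedMatrix μ A i j := by
  simp only [expectedMatrix, Matrix.of_apply, hA.symm _ i j]

theorem expectedMatrix_apply (hA : IsIndepEdgeWeightedGraph μ W P A)
    (hP : ∀ i j, P i j ∈ Set.Icc (0 : ℝ) 1) (e : EdgeIndex n) :
    expectedMatrix μ A e.1.1 e.1.2 = P e.1.1 e.1.2 * W e.1.1 e.1.2 := by
  rw [expectedMatrix, Matrix.of_apply, ← integral_bernoulli (hP _ _), ← hA.law _ _ e.2,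
    integral_map (hA.measurable _ _).aemeasurable (by fun_prop)]

theorem laplacian_sub_eq_sum (hA : IsIndepEdgeWeightedGraph μ W P A)
    (hP : ∀ i j, P i j ∈ Set.Icc (0 : ℝ) 1) (ω : Ω) :
    weightedLaplacian (A ω) - weightedLaplacian (expectedMatrix μ A) =
      ∑ e : EdgeIndex n, (A ω e.1.1 e.1.2 - P e.1.1 e.1.2 * W e.1.1 e.1.2) • e.laplacian := by
  rw [weightedLaplacian_eq_sum (hA.symm ω), weightedLaplacian_eq_sum hA.expectedMatrix_symm,
    ← Finset.sum_sub_distrib]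
  exact Finset.sum_congr rfl fun e _ => by rw [hA.expectedMatrix_apply hP, sub_smul]

theorem map_entries (hA : IsIndepEdgeWeightedGraph μ W P A)
    (hP : ∀ i j, P i j ∈ Set.Icc (0 : ℝ) 1) [IsProbabilityMeasure μ] :
    μ.map (fun ω (e : EdgeIndex n) => A ω e.1.1 e.1.2) =
      (Measure.pi fun e : EdgeIndex n => bernoulliLaw (P e.1.1 e.1.2)).map
        fun x e => if x e then W e.1.1 e.1.2 else 0 := by
  have : ∀ e : EdgeIndex n, IsProbabilityMeasure (bernoulliLaw (P e.1.1 e.1.2)) := fun e =>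
    isProbabilityMeasure_bernoulliLaw (hP _ _)
  have hmeas : ∀ e : EdgeIndex n, Measurable fun b : Bool => if b then W e.1.1 e.1.2 else 0 :=
    fun e => measurable_of_countable _
  have : ∀ e : EdgeIndex n, IsProbabilityMeasure
      ((bernoulliLaw (P e.1.1 e.1.2)).map fun b => if b then W e.1.1 e.1.2 else 0) := fun e =>
    Measure.isProbabilityMeasure_map (hmeas e).aemeasurable
  have hmap := Measure.pi_map_pi (μ := fun e : EdgeIndex n => bernoulliLaw (P e.1.1 e.1.2))
    (f := fun (e : EdgeIndex n) (b : Bool) => if b then W e.1.1 e.1.2 else 0)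
    fun e => (hmeas e).aemeasurable
  refine (hA.indep.map_fun_eq_pi_map fun e => (hA.measurable _ _).aemeasurable).trans
    (Eq.trans ?_ hmap.symm)
  congr 1
  funext e
  rw [hA.law _ _ e.2, map_bernoulliLaw]

/-- The norm depends only on the independent entries, whose joint law is the image of a Bernoulli
product; the probability becomes a finite weighted sum. -/
theorem measureReal_norm_laplacian_gt (hA : IsIndepEdgeWeightedGraph μ W P A)
    (hP : ∀ i j, P i j ∈ Set.Icc (0 : ℝ) 1) [IsProbabilityMeasure μ] (t : ℝ) :
    μ.real {ω | t < ‖weightedLaplacian (A ω) - weightedLaplacian (expectedMatrix μ A)‖} =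
      ∑ x : EdgeIndex n → Bool with t < ‖∑ e : EdgeIndex n, ((if x e then W e.1.1 e.1.2 else 0) -
        P e.1.1 e.1.2 * W e.1.1 e.1.2) • e.laplacian‖,
        prodWeight (fun e => bernoulliWeight (P e.1.1 e.1.2)) x := by
  set F : (EdgeIndex n → ℝ) → ℝ := fun v =>
    ‖∑ e : EdgeIndex n, (v e - P e.1.1 e.1.2 * W e.1.1 e.1.2) • e.laplacian‖ with hF
  have hFc : Continuous F := by fun_prop
  have hS : MeasurableSet {v | t < F v} := (isOpen_lt continuous_const hFc).measurableSet
  have hAm : Measurable fun ω (e : EdgeIndex n) => A ω e.1.1 e.1.2 :=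
    measurable_pi_lambda _ fun e => hA.measurable _ _
  have h1 : {ω | t < ‖weightedLaplacian (A ω) - weightedLaplacian (expectedMatrix μ A)‖} =
      (fun ω (e : EdgeIndex n) => A ω e.1.1 e.1.2) ⁻¹' {v | t < F v} := by
    ext ω
    simp only [Set.mem_ofPred_eq, Set.mem_preimage, hA.laplacian_sub_eq_sum hP, hF]
  rw [h1, ← map_measureReal_apply hAm hS, hA.map_entries hP,
    map_measureReal_apply (measurable_of_countable _) hS,
    ← measureReal_pi_bernoulliLaw fun e : EdgeIndex n => hP e.1.1 e.1.2]
  congr 1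
  ext x
  simp [hF]

end IsIndepEdgeWeightedGraph

end RandomGraph

/-! ### Mean, variance and size of a centered edge weight. -/

section Centered

theorem sum_bernoulliWeight_mul_centered (p w : ℝ) :
    ∑ b, bernoulliWeight p b * ((if b then w else 0) - p * w) = 0 := by
  simp [bernoulliWeight]
  ring

theorem sum_bernoulliWeight_mul_centered_sq_le (p w : ℝ) :
    ∑ b, bernoulliWeight p b * ((if b then w else 0) - p * w) ^ 2 ≤ p * w ^ 2 := by
  simp [bernoulliWeight]
  nlinarith [sq_nonneg (p * w)]

theorem abs_centered_le_one {p w : ℝ} (hp : p ∈ Set.Icc (0 : ℝ) 1) (hw : |w| ≤ 1) (b : Bool) :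
    |(if b then w else 0) - p * w| ≤ 1 := by
  obtain ⟨h0, h1⟩ := hp
  cases b
  · simp only [Bool.false_eq_true, if_false, zero_sub, abs_neg, abs_mul, abs_of_nonneg h0]
    exact mul_le_one₀ h1 (abs_nonneg w) hw
  · have : w - p * w = (1 - p) * w := by ring
    simp only [if_true, this, abs_mul, abs_of_nonneg (sub_nonneg.2 h1)]
    exact mul_le_one₀ (by linarith) (abs_nonneg w) hw

end Centered

/-! ### Parameter ranges and conclusion. -/

theorem log_bounds_of_rpow_le {n : ℕ} (hn : 0 < n) {c δ D : ℝ}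
    (hD : 16 * (c + 1) * Real.log n ≤ D) (hδ : 4 * (n : ℝ) ^ (-c) ≤ δ) (hδ1 : δ < 1) :
    2 ≤ Real.log (4 * n / δ) ∧ 16 * Real.log (4 * n / δ) ≤ D := by
  have hnpos : (0 : ℝ) < n := Nat.cast_pos.2 hn
  have hpow : 0 < (n : ℝ) ^ (-c) := Real.rpow_pos_of_pos hnpos _
  have hδ0 : 0 < δ := by linarith
  have hn2 : 2 ≤ n := by
    -- For `n = 1` the hypotheses would give `4 ≤ δ < 1`. Hence `4 * n / δ ≥ 8 ≥ exp 2`.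
    by_contra h
    obtain rfl : n = 1 := by omega
    norm_num at hδ
    linarith
  constructor
  · rw [Real.le_log_iff_exp_le (by positivity), le_div_iff₀ hδ0]
    have he : Real.exp 2 ≤ 8 := by
      rw [show (2 : ℝ) = 1 + 1 by norm_num, Real.exp_add]
      nlinarith [Real.exp_one_lt_d9, Real.exp_pos 1]
    have : (2 : ℝ) ≤ n := by exact_mod_cast hn2
    nlinarith [Real.exp_pos 2]
  · have hlog : Real.log (4 * n / δ) ≤ (c + 1) * Real.log n := by
      rw [← Real.log_rpow hnpos]
      refine Real.log_le_log (by positivity) ?_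
      rw [div_le_iff₀ hδ0]
      calc 4 * (n : ℝ) = (n : ℝ) ^ (c + 1) * (4 * (n : ℝ) ^ (-c)) := by
            rw [mul_left_comm, ← Real.rpow_add hnpos]
            norm_num
        _ ≤ _ := by gcongr
    linarith

theorem proposition1 {n : ℕ} (hn : 0 < n) {Ω : Type*} [MeasurableSpace Ω]
    (μ : Measure Ω) [IsProbabilityMeasure μ]
    (W P : Matrix (Fin n) (Fin n) ℝ)
    (hWsymm : W.IsSymm) (hPsymm : P.IsSymm)
    (hP : ∀ i j, P i j ∈ Set.Icc (0 : ℝ) 1)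
    (hW : ∀ i j, |W i j| ≤ 1)
    (A : Ω → Matrix (Fin n) (Fin n) ℝ)
    (hA : IsIndepEdgeWeightedGraph μ W P A)
    (c : ℝ) (hc : 0 < c)
    (hΔ : 16 * (c + 1) * Real.log n ≤ maxWeightedDegree W P)
    (δ : ℝ) (hδ : 4 * (n : ℝ) ^ (-c) ≤ δ) (hδ1 : δ < 1) :
    1 - δ ≤ μ.real {ω | ‖weightedLaplacian (A ω) - weightedLaplacian (expectedMatrix μ A)‖ ≤
      8 * √(maxWeightedDegree W P * Real.log (4 * n / δ))} := by
  set D := maxWeightedDegree W P with hDdef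
  obtain ⟨hl2, hlD⟩ := log_bounds_of_rpow_le hn hΔ hδ hδ1
  set l := Real.log (4 * n / δ) with hldef
  have hnpos : (0 : ℝ) < n := Nat.cast_pos.2 hn
  have hδ0 : 0 < δ := by linarith [Real.rpow_pos_of_pos hnpos (-c)]
  have hD : 0 < D := by linarith
  have hvar : ∀ k, ∑ e : EdgeIndex n, e.laplacian k k *
      ∑ b, bernoulliWeight (P e.1.1 e.1.2) b *
        ((if b then W e.1.1 e.1.2 else 0) - P e.1.1 e.1.2 * W e.1.1 e.1.2) ^ 2 ≤ D := by
    intro k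
    calc _ ≤ ∑ e : EdgeIndex n, e.laplacian k k * (P e.1.1 e.1.2 * W e.1.1 e.1.2 ^ 2) :=
          Finset.sum_le_sum fun e _ => mul_le_mul_of_nonneg_left
            (sum_bernoulliWeight_mul_centered_sq_le _ _) (e.laplacian_apply_self_mem k).1
      _ ≤ ∑ j, P k j * W k j ^ 2 := by
          have h := sum_edgeIndex_laplacian_apply_self_le
            (M := Matrix.of fun i j => P i j * W i j ^ 2)
            (fun i j => by simp only [Matrix.of_apply, hPsymm.apply i j, hWsymm.apply i j])
            (fun i => mul_nonneg (hP i i).1 (sq_nonneg _)) k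
          simpa only [Matrix.of_apply] using h
      _ ≤ D := le_ciSup (f := fun i => ∑ j, P i j * W i j ^ 2) (Set.finite_range _).bddAbove k
  have htail := sum_prodWeight_norm_laplacian_gt_le hn
    (q := fun e : EdgeIndex n => bernoulliWeight (P e.1.1 e.1.2))
    (y := fun e b => (if b then W e.1.1 e.1.2 else 0) - P e.1.1 e.1.2 * W e.1.1 e.1.2)
    (fun e => bernoulliWeight_nonneg (hP _ _)) (fun e => sum_bernoulliWeight _)
    (fun e => sum_bernoulliWeight_mul_centered _ _)
    (fun e => abs_centered_le_one (hP _ _) (hW _ _)) hD hvar hl2 hlD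
  rw [← hA.measureReal_norm_laplacian_gt hP] at htail
  -- The left side equals `δ ^ 2 / 16`: doubling `l` in the exponent cancels the dimensional factor
  -- `n ^ 2`.
  have hexp : (n : ℝ) ^ 2 * Real.exp (-(2 * l)) ≤ δ := by
    have h1 : Real.exp (-(2 * l)) = (δ / (4 * n)) ^ 2 := by
      rw [Real.exp_neg, ← Nat.cast_two, Real.exp_nat_mul, hldef, Real.exp_log (by positivity),
        ← inv_pow, inv_div]
    have h2 : (n : ℝ) ^ 2 * (δ / (4 * n)) ^ 2 = δ ^ 2 / 16 := by field_simp; norm_num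
    rw [h1, h2]
    nlinarith
  have hcompl : {ω | ‖weightedLaplacian (A ω) - weightedLaplacian (expectedMatrix μ A)‖ ≤
      8 * √(D * l)}ᶜ = {ω | 8 * √(D * l) <
        ‖weightedLaplacian (A ω) - weightedLaplacian (expectedMatrix μ A)‖} := by
    ext ω
    simp
  have hunion := measureReal_union_le (μ := μ)
    {ω | ‖weightedLaplacian (A ω) - weightedLaplacian (expectedMatrix μ A)‖ ≤ 8 * √(D * l)}
    {ω | ‖weightedLaplacian (A ω) - weightedLaplacian (expectedMatrix μ A)‖ ≤ 8 * √(D * l)}ᶜ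
  rw [Set.union_compl_self, hcompl, probReal_univ] at hunion
  linarith
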